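/- There are $n$ agents and a matroid $\mathcal J$ on $[n]$, whose independent sets are the sets of agents that may be served together. The values $v_1,\dots,v_n\ge 0$ are independent, $v_i$ having an arbitrary distribution $F_i$ (not necessarily regular, point masses allowed) with finite single-buyer revenue, $\sup_z z\,\Pr[v_i\ge z]<\infty$. For an allocation rule $A$, mapping value vectors to sets in $\mathcal J$, let an agent that is not served pay nothing, and let a served agent pay the infimum of the values $z\ge 0$ at which it would be served if it reported $z$ and the other values were unchanged; the expected revenue of $A$ is the expected sum of these payments. *Myerson's mechanism.* Let $R_i(q)=q\,F_i^{-1}(1-q)$ for $q\in[0,1]$, where $F_i^{-1}(1-q)=\sup\{z:\Pr[v_i\ge z]\ge q\}$ for $q>0$ and $R_i(0)=0$; let $\bar R_i$ be the least concave majorant of $R_i$ on $[0,1]$, and let the ironed virtual value $\bar\phi_i(z)$ be the right derivative of $\bar R_i$ at $q=1-F_i(z)$ (equal to $-\infty$ if $F_i(z)=0$). Myerson's mechanism serves a set $S\in\mathcal J$ that maximizes $\sum_{i\in S}\bar\phi_i(v_i)$, ties being broken by a (measurable) rule that depends only on the vector of ironed virtual values. *VCG with reserve prices $p$.* It serves a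 set $S\in\mathcal J$ that maximizes $\sum_{i\in S}v_i$ among the sets in $\mathcal J$ with $v_i\ge p_i$ for all $i\in S$, ties being broken arbitrarily. Then there are reserve prices $p_1,\dots,p_n\ge 0$ such that the expected revenue of the VCG mechanism with reserve prices $p$ is at least half of the expected revenue of Myerson's mechanism. -/

import Mathlib

open MeasureTheory Set
open scoped ENNReal

namespace BSMD

noncomputable section

/-- The price at which a buyer with value law `μ` buys with probability `q`, i.e. `F⁻¹(1 - q)`:
the largest `z` with `P(V ≥ z) ≥ q` (used for `0 < q ≤ 1`). -/
def priceAtQuantile (μ : Measure ℝ) (q : ℝ) : ℝ :=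
  sSup {z : ℝ | q ≤ μ.real (Ici z)}

/-- The revenue curve `R(q) = q · F⁻¹(1 - q)`, with `R(0) = 0`. -/
def revenueCurve (μ : Measure ℝ) (q : ℝ) : ℝ :=
  q * priceAtQuantile μ q

/-- The ironed revenue curve: the least concave majorant of the revenue curve on `[0, 1]`. -/
def ironedRevenueCurve (μ : Measure ℝ) (q : ℝ) : ℝ :=
  sInf {y : ℝ | ∃ g : ℝ → ℝ, ConcaveOn ℝ (Icc 0 1) g ∧
    (∀ x ∈ Icc (0 : ℝ) 1, revenueCurve μ x ≤ g x) ∧ y = g q}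

/-- The ironed virtual value of the value `z`: the right derivative of the ironed revenue curve at
the quantile `q = 1 - F(z) = P(V > z)`. The curve being concave, the right derivative is the
supremum of the difference quotients to the right. It is `-∞` when `q = 1`, that is, for values
below the support. For a regular distribution with density `f` it is `z - (1 - F z) / f z`. -/
def ironedVirtualValue (μ : Measure ℝ) (z : ℝ) : EReal :=
  ⨆ x ∈ Ioc (μ.real (Ioi z)) 1,
    (((ironedRevenueCurve μ x - ironedRevenueCurve μ (μ.real (Ioi z))) /
      (x - μ.real (Ioi z)) : ℝ) : EReal)

variable {n : ℕ}

/-- The payments that go with an allocation rule `A` in a truthful mechanism in which agents that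
are not served pay nothing: a served agent pays the smallest nonnegative value at which, the other
values being fixed, it would still be served. -/
def thresholdPrice (A : (Fin n → ℝ) → Finset (Fin n)) (v : Fin n → ℝ) (i : Fin n) : ℝ :=
  open Classical in
  if i ∈ A v then sInf {z : ℝ | 0 ≤ z ∧ i ∈ A (Function.update v i z)} else 0

/-- The expected revenue of the mechanism with allocation rule `A` and threshold payments, when the
values of the agents are independent with laws `μ i`. The payments are nonnegative. -/
def expectedRevenue (μ : Fin n → Measure ℝ) (A : (Fin n → ℝ) → Finset (Fin n)) : ℝ≥0∞ :=
  ∫⁻ v, ∑ i, ENNReal.ofReal (thresholdPrice A v i) ∂(Measure.pi μ)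

/-- `A` is the allocation rule of Myerson's mechanism: it serves a feasible set of maximal ironed
virtual surplus, and it breaks ties consistently, i.e. (measurably) as a function `T` of the
vector of ironed virtual values. -/
structure IsMyerson (J : Matroid (Fin n)) (μ : Fin n → Measure ℝ)
    (A : (Fin n → ℝ) → Finset (Fin n)) : Prop where
  feasible : ∀ v, J.Indep (A v : Set (Fin n))
  optimal : ∀ v, ∀ S : Finset (Fin n), J.Indep (S : Set (Fin n)) →
    ∑ i ∈ S, ironedVirtualValue (μ i) (v i) ≤ ∑ i ∈ A v, ironedVirtualValue (μ i) (v i)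
  consistent : ∃ T : (Fin n → EReal) → Finset (Fin n),
    (∀ i, MeasurableSet {w | i ∈ T w}) ∧
      ∀ v, A v = T (fun i => ironedVirtualValue (μ i) (v i))

/-- `A` is an allocation rule of the VCG mechanism with reserve prices `p`: among the feasible sets
of agents whose values meet their reserves, it serves one with the largest total value. Ties may be
broken in any way. -/
structure IsVCG (J : Matroid (Fin n)) (p : Fin n → ℝ)
    (A : (Fin n → ℝ) → Finset (Fin n)) : Prop where
  feasible : ∀ v, J.Indep (A v : Set (Fin n))
  reserve : ∀ v, ∀ i ∈ A v, p i ≤ v i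
  optimal : ∀ v, ∀ S : Finset (Fin n), J.Indep (S : Set (Fin n)) → (∀ i ∈ S, p i ≤ v i) →
    ∑ i ∈ S, v i ≤ ∑ i ∈ A v, v i

end

end BSMD

namespace BSMD

noncomputable section

/-! ### Measurability and monotonicity of the ironed virtual value -/

section IronedVirtualValue

variable {μ : Measure ℝ}

/-! The reserves are sampled. Draw an independent market `w i` for each agent `i`, and let `p i` be
the price that Myerson's mechanism would quote to `i` there. This price ignores the `i`-th
coordinate of `w i`, so that coordinate may be replaced by the real value `v i`; the resulting
markets are independent across agents.

Fix a price level `s`. The events "in its own market, `i` is served at a price above `s`" are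
independent, and their probabilities are those in the original mechanism, where such agents form an
independent set; so the marginals lie in the matroid polytope. Hence the random set of these agents
has expected rank at least half its expected size (`sum_measure_le_two_mul_lintegral_eRk`). Each
agent in it has `s < p i ≤ v i`, and under VCG at least as many agents pay more than `s` as the rank
of the agents with `s < p i ≤ v i` (`IsVCG.eRk_le_encard`). Integrating over `s` gives the factor 2
on average over `w`, so some `w` attains it.

Of Myerson's mechanism only feasibility, measurability and monotonicity enter; ironed virtual values
serve to establish the last two. -/

lemma revenueCurve_le_ironedRevenueCurve {g : ℝ → ℝ} (hg : ConcaveOn ℝ (Icc 0 1) g)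
    (hRg : ∀ x ∈ Icc (0 : ℝ) 1, revenueCurve μ x ≤ g x) {t : ℝ} (ht : t ∈ Icc (0 : ℝ) 1) :
    revenueCurve μ t ≤ ironedRevenueCurve μ t :=
  le_csInf ⟨_, g, hg, hRg, rfl⟩ (by rintro _ ⟨g', -, h, rfl⟩; exact h t ht)

lemma ironedRevenueCurve_le {g : ℝ → ℝ} (hg : ConcaveOn ℝ (Icc 0 1) g)
    (hRg : ∀ x ∈ Icc (0 : ℝ) 1, revenueCurve μ x ≤ g x) {t : ℝ} (ht : t ∈ Icc (0 : ℝ) 1) :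
    ironedRevenueCurve μ t ≤ g t :=
  csInf_le ⟨revenueCurve μ t, by rintro _ ⟨g', -, h, rfl⟩; exact h t ht⟩ ⟨g, hg, hRg, rfl⟩

variable [IsProbabilityMeasure μ]

lemma real_Ici_zero (hnonneg : μ (Iio 0) = 0) : μ.real (Ici 0) = 1 := by
  have h : μ (Ici 0) = 1 := by
    rw [← compl_Iio, prob_compl_eq_one_iff measurableSet_Iio]
    exact hnonneg
  simp [Measure.real, h]

lemma revenueCurve_le_of_forall_le {c x : ℝ} (hx : x ∈ Icc (0 : ℝ) 1)
    (hnonneg : μ (Iio 0) = 0) (h : ∀ z, 0 < x → x ≤ μ.real (Ici z) → x * z ≤ c) (hc : 0 ≤ c) :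
    revenueCurve μ x ≤ c := by
  rcases hx.1.eq_or_lt with h0 | h0
  · simp [revenueCurve, ← h0, hc]
  · have hne : {z : ℝ | x ≤ μ.real (Ici z)}.Nonempty :=
      ⟨0, by simpa [real_Ici_zero hnonneg] using hx.2⟩
    have : priceAtQuantile μ x ≤ c / x :=
      csSup_le hne fun z hz => by
        rw [le_div_iff₀ h0, mul_comm]
        exact h z h0 hz
    rw [revenueCurve, mul_comm]
    exact (le_div_iff₀ h0).1 this

variable (hnonneg : μ (Iio 0) = 0) (hfin : BddAbove (range fun z : ℝ => z * μ.real (Ici z)))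
include hnonneg hfin

lemma exists_revenueCurve_le : ∃ B, ∀ x ∈ Icc (0 : ℝ) 1, revenueCurve μ x ≤ B := by
  obtain ⟨B, hB⟩ := hfin
  refine ⟨max B 0, fun x hx => revenueCurve_le_of_forall_le hx hnonneg (fun z h0 hz => ?_)
    (le_max_right _ _)⟩
  rcases le_total z 0 with h | h
  · exact (mul_nonpos_of_nonneg_of_nonpos h0.le h).trans (le_max_right _ _)
  · have h1 : z * μ.real (Ici z) ≤ B := hB ⟨z, rfl⟩
    have h2 : x * z ≤ z * μ.real (Ici z) := by nlinarith
    exact (h2.trans h1).trans (le_max_left _ _)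

lemma concaveOn_ironedRevenueCurve : ConcaveOn ℝ (Icc 0 1) (ironedRevenueCurve μ) := by
  obtain ⟨B, hB⟩ := exists_revenueCurve_le hnonneg hfin
  refine ⟨convex_Icc 0 1, fun x hx y hy a b ha hb hab => ?_⟩
  refine le_csInf ⟨B, fun _ => B, concaveOn_const B (convex_Icc 0 1), hB, rfl⟩ ?_
  rintro _ ⟨g, hg, hRg, rfl⟩
  refine le_trans ?_ (hg.2 hx hy ha hb hab)
  simp only [smul_eq_mul]
  gcongr
  exacts [ironedRevenueCurve_le hg hRg hx, ironedRevenueCurve_le hg hRg hy]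

lemma ironedVirtualValue_monotone : Monotone (ironedVirtualValue μ) := by
  intro z z' hz
  have hq : μ.real (Ioi z') ≤ μ.real (Ioi z) := measureReal_mono (Ioi_subset_Ioi hz)
  have hc := concaveOn_ironedRevenueCurve hnonneg hfin
  refine iSup₂_le fun x hx => ?_
  refine le_trans ?_ (le_iSup₂ (f := fun x (_ : x ∈ Ioc (μ.real (Ioi z')) 1) =>
    (((ironedRevenueCurve μ x - ironedRevenueCurve μ (μ.real (Ioi z'))) /
      (x - μ.real (Ioi z')) : ℝ) : EReal)) x ⟨hq.trans_lt hx.1, hx.2⟩)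
  rw [EReal.coe_le_coe_iff]
  have h0 : (0 : ℝ) ≤ μ.real (Ioi z') := measureReal_nonneg
  rcases hq.eq_or_lt with h | h
  · rw [h]
  -- The chord over the whole interval has a slope between those of its two pieces, and the right
  -- piece has the smaller one.
  · have h1 := hc.slope_anti_adjacent (x := μ.real (Ioi z')) (y := μ.real (Ioi z)) (z := x)
      ⟨h0, by linarith [hx.1, hx.2]⟩ ⟨by linarith [hx.1], hx.2⟩ h hx.1
    have ha : 0 < μ.real (Ioi z) - μ.real (Ioi z') := by linarith
    have hb : 0 < x - μ.real (Ioi z) := by linarith [hx.1]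
    rw [div_le_div_iff₀ hb ha] at h1
    rw [div_le_div_iff₀ hb (by linarith)]
    nlinarith

/-- At a positive quantile, concavity bounds the slopes to the right by the slope from 0. At
quantile 0 there is no mass above `z`, so `x ↦ z * x` is a concave majorant and bounds them by `z`.
-/
lemma ironedVirtualValue_ne_top (z : ℝ) : ironedVirtualValue μ z ≠ ⊤ := by
  suffices ∃ c : ℝ, ∀ x ∈ Ioc (μ.real (Ioi z)) 1,
      (ironedRevenueCurve μ x - ironedRevenueCurve μ (μ.real (Ioi z))) /
        (x - μ.real (Ioi z)) ≤ c by
    obtain ⟨c, hc⟩ := this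
    refine ne_of_lt (lt_of_le_of_lt (iSup₂_le fun x hx => ?_) (EReal.coe_lt_top c))
    exact EReal.coe_le_coe_iff.2 (hc x hx)
  have h0 : (0 : ℝ) ≤ μ.real (Ioi z) := measureReal_nonneg
  rcases h0.eq_or_lt with h | h
  · have hz : 0 ≤ z := by
      by_contra! hz
      have : μ.real (Ici 0) ≤ μ.real (Ioi z) := measureReal_mono (Ici_subset_Ioi.2 hz)
      rw [real_Ici_zero hnonneg] at this
      linarith
    have hg : ConcaveOn ℝ (Icc 0 1) fun x : ℝ => z * x :=
      ⟨convex_Icc 0 1, fun x _ y _ a b _ _ _ => le_of_eq (by simp only [smul_eq_mul]; ring)⟩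
    have hRg : ∀ x ∈ Icc (0 : ℝ) 1, revenueCurve μ x ≤ z * x := by
      intro x hx
      refine revenueCurve_le_of_forall_le hx hnonneg (fun y hx0 hy => ?_) (mul_nonneg hz hx.1)
      have : y ≤ z := by
        by_contra! hlt
        have : μ.real (Ici y) ≤ μ.real (Ioi z) := measureReal_mono (Ici_subset_Ioi.2 hlt)
        linarith
      nlinarith
    have hR0 : 0 ≤ ironedRevenueCurve μ 0 := by
      have := revenueCurve_le_ironedRevenueCurve hg hRg (t := 0) (by simp)
      simpa [revenueCurve] using this
    refine ⟨z, fun x hx => ?_⟩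
    rw [← h] at hx ⊢
    have := ironedRevenueCurve_le hg hRg ⟨hx.1.le, hx.2⟩
    rw [div_le_iff₀ (by linarith [hx.1])]
    simp only [sub_zero]
    linarith
  · refine ⟨_, fun x hx => (concaveOn_ironedRevenueCurve hnonneg hfin).slope_anti_adjacent
      (x := 0) (y := μ.real (Ioi z)) (z := x) (by simp) ⟨by linarith [hx.1], hx.2⟩ h hx.1⟩

end IronedVirtualValue

/-! ### Critical values -/

variable {n : ℕ}

/-- The price that agent `i` pays if served: the smallest nonnegative report at which the rule `A`
serves it, the reports of the others being fixed. -/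
def criticalValue (A : (Fin n → ℝ) → Finset (Fin n)) (i : Fin n) (v : Fin n → ℝ) : ℝ :=
  sInf {z : ℝ | 0 ≤ z ∧ i ∈ A (Function.update v i z)}

lemma criticalValue_nonneg (A : (Fin n → ℝ) → Finset (Fin n)) (i : Fin n) (v : Fin n → ℝ) :
    0 ≤ criticalValue A i v :=
  Real.sInf_nonneg fun _ hz => hz.1

lemma criticalValue_update (A : (Fin n → ℝ) → Finset (Fin n)) (i : Fin n) (v : Fin n → ℝ)
    (z : ℝ) : criticalValue A i (Function.update v i z) = criticalValue A i v := by
  simp [criticalValue]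

lemma criticalValue_le {A : (Fin n → ℝ) → Finset (Fin n)} {i : Fin n} {v : Fin n → ℝ}
    (hi : i ∈ A v) (hv : 0 ≤ v i) : criticalValue A i v ≤ v i :=
  csInf_le ⟨0, fun _ hz => hz.1⟩ ⟨hv, by simpa using hi⟩

lemma le_criticalValue {A : (Fin n → ℝ) → Finset (Fin n)} {i : Fin n} {v : Fin n → ℝ}
    (hi : i ∈ A v) (hv : 0 ≤ v i) {c : ℝ}
    (h : ∀ z, 0 ≤ z → i ∈ A (Function.update v i z) → c ≤ z) : c ≤ criticalValue A i v :=
  le_csInf ⟨v i, hv, by simpa using hi⟩ fun z hz => h z hz.1 hz.2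

lemma thresholdPrice_of_mem {A : (Fin n → ℝ) → Finset (Fin n)} {i : Fin n} {v : Fin n → ℝ}
    (hi : i ∈ A v) : thresholdPrice A v i = criticalValue A i v := by
  simp [thresholdPrice, criticalValue, hi]

/-- A rule is monotone if a served agent is still served when it raises its report. -/
def IsMonotoneRule (A : (Fin n → ℝ) → Finset (Fin n)) : Prop :=
  ∀ v i z, i ∈ A v → v i ≤ z → i ∈ A (Function.update v i z)

/-- By monotonicity it suffices to test rational reports. An agent that is never served needs
separate care, because `sInf ∅ = 0`. -/
lemma measurable_criticalValue {A : (Fin n → ℝ) → Finset (Fin n)} (hA : IsMonotoneRule A)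
    {i : Fin n} (hm : MeasurableSet {v | i ∈ A v}) : Measurable (criticalValue A i) := by
  have hm' (z : ℝ) : MeasurableSet {v : Fin n → ℝ | i ∈ A (Function.update v i z)} :=
    measurableSet_preimage (f := fun v : Fin n → ℝ => Function.update v i z)
      measurable_update_left hm
  have hup {v : Fin n → ℝ} {z z' : ℝ} (h : i ∈ A (Function.update v i z)) (hz : z ≤ z') :
      i ∈ A (Function.update v i z') := by
    simpa using hA _ i z' h (by simpa using hz)
  -- the set where the critical value is an infimum over the empty set
  set N : Set (Fin n → ℝ) := {v | ∀ k : ℕ, i ∉ A (Function.update v i k)} with hN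
  have hNm : MeasurableSet N := by
    rw [hN, ofPred_forall]
    exact MeasurableSet.iInter fun k => (hm' k).compl
  refine measurable_of_Iio fun c => ?_
  have key : criticalValue A i ⁻¹' Iio c = (if 0 < c then N else ∅) ∪
      ⋃ r : {r : ℚ // 0 ≤ r ∧ (r : ℝ) < c},
        {v | i ∈ A (Function.update v i ((r : ℚ) : ℝ))} := by
    ext v
    simp only [mem_preimage, mem_Iio, mem_union, mem_iUnion, mem_ofPred_eq, Subtype.exists,
      exists_prop]
    constructor
    · intro h
      by_cases hv : v ∈ N
      · left
        rw [if_pos ((criticalValue_nonneg A i v).trans_lt h)]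
        exact hv
      · right
        simp only [hN, mem_ofPred_eq, not_forall, not_not] at hv
        obtain ⟨k, hk⟩ := hv
        obtain ⟨z, ⟨hz0, hz⟩, hzc⟩ := exists_lt_of_csInf_lt
          (s := {z : ℝ | 0 ≤ z ∧ i ∈ A (Function.update v i z)})
          ⟨k, Nat.cast_nonneg k, hk⟩ h
        obtain ⟨r, hr1, hr2⟩ := exists_rat_btwn hzc
        exact ⟨r, ⟨by exact_mod_cast hz0.trans hr1.le, hr2⟩, hup hz hr1.le⟩
    · rintro (h | ⟨r, ⟨hr0, hrc⟩, hr⟩)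
      · split_ifs at h with hc
        · have : {z : ℝ | 0 ≤ z ∧ i ∈ A (Function.update v i z)} = ∅ := by
            ext z
            simp only [mem_ofPred_eq, mem_empty_iff_false, iff_false, not_and]
            intro _ hz
            obtain ⟨k, hk⟩ := exists_nat_ge z
            exact h k (hup hz hk)
          simpa [criticalValue, this] using hc
        · exact h.elim
      · exact (csInf_le ⟨0, fun _ hz => hz.1⟩
          ⟨by exact_mod_cast hr0, hr⟩ : criticalValue A i v ≤ r).trans_lt hrc
  rw [key]
  refine MeasurableSet.union ?_ (MeasurableSet.iUnion fun r => hm' _)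
  split_ifs
  exacts [hNm, MeasurableSet.empty]

section Myerson

variable {J : Matroid (Fin n)} {μ : Fin n → Measure ℝ} [∀ i, IsProbabilityMeasure (μ i)]
  (hnonneg : ∀ i, μ i (Iio 0) = 0)
  (hfin : ∀ i, BddAbove (range fun z : ℝ => z * (μ i).real (Ici z)))
  {A : (Fin n → ℝ) → Finset (Fin n)} (hA : IsMyerson J μ A)
include hnonneg hfin hA

lemma IsMyerson.measurableSet_mem (i : Fin n) : MeasurableSet {v | i ∈ A v} := by
  obtain ⟨T, hT, h⟩ := hA.consistent
  simp_rw [h]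
  refine measurableSet_preimage (f := fun v : Fin n → ℝ =>
    fun j => ironedVirtualValue (μ j) (v j)) ?_ (hT i)
  exact measurable_pi_lambda _ fun j =>
    (ironedVirtualValue_monotone (hnonneg j) (hfin j)).measurable.comp (measurable_pi_apply j)

/-- If the ironed virtual value does not change, consistent tie-breaking gives the same set. If it
rises strictly and the agent is dropped, comparing the two optimal sets at both profiles gives a
contradiction, once the surplus of the other agents is known to be finite. -/
lemma IsMyerson.isMonotoneRule : IsMonotoneRule A := by
  intro v i z hi hz
  by_contra hi'
  set v' := Function.update v i z with hv'
  set φ : Fin n → ℝ → EReal := fun j => ironedVirtualValue (μ j) with hφ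
  have hagree : ∀ j, j ≠ i → φ j (v' j) = φ j (v j) := fun j hj => by simp [hv', hj]
  have hle : φ i (v i) ≤ φ i (v' i) := by
    simpa [hv'] using ironedVirtualValue_monotone (hnonneg i) (hfin i) hz
  have hlt : φ i (v i) < φ i (v' i) := by
    refine hle.lt_of_ne fun heq => hi' ?_
    obtain ⟨T, -, hT⟩ := hA.consistent
    have : (fun j => ironedVirtualValue (μ j) (v' j)) =
        fun j => ironedVirtualValue (μ j) (v j) := by
      funext j
      by_cases hj : j = i
      · subst hj; exact heq.symm
      · exact hagree j hj
    rw [hT v', this, ← hT v]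
    exact hi
  have h1 := hA.optimal v (A v') (hA.feasible v')
  have h2 := hA.optimal v' (A v) (hA.feasible v)
  have h0 := hA.optimal v ∅ (by simp)
  have h3 : ∑ j ∈ A v', φ j (v' j) = ∑ j ∈ A v', φ j (v j) :=
    Finset.sum_congr rfl fun j hj => hagree j (by rintro rfl; exact hi' hj)
  have h4 : ∑ j ∈ (A v).erase i, φ j (v' j) = ∑ j ∈ (A v).erase i, φ j (v j) :=
    Finset.sum_congr rfl fun j hj => hagree j (Finset.ne_of_mem_erase hj)
  change ∑ j ∈ A v', φ j (v j) ≤ ∑ j ∈ A v, φ j (v j) at h1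
  change ∑ j ∈ A v, φ j (v' j) ≤ ∑ j ∈ A v', φ j (v' j) at h2
  change ∑ j ∈ ∅, φ j (v j) ≤ ∑ j ∈ A v, φ j (v j) at h0
  have h5 := (h2.trans_eq h3).trans h1
  rw [← Finset.add_sum_erase _ _ hi, ← Finset.add_sum_erase _ _ hi, h4] at h5
  rw [← Finset.add_sum_erase _ _ hi, Finset.sum_empty] at h0
  generalize hC : ∑ j ∈ (A v).erase i, φ j (v j) = C at h0 h5
  -- Cancelling `C` in `EReal` requires finiteness: comparison with the empty set excludes `⊥`.
  have hbot : C ≠ ⊥ := by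
    intro h
    rw [h, EReal.add_bot] at h0
    simp at h0
  have htop : C ≠ ⊤ := by
    have : ∀ s : Finset (Fin n), ∑ j ∈ s, φ j (v j) ≠ ⊤ := by
      intro s
      induction s using Finset.induction_on with
      | empty => simp
      | insert a s ha ih =>
        rw [Finset.sum_insert ha]
        exact (EReal.add_lt_top (ironedVirtualValue_ne_top (hnonneg a) (hfin a) _) ih).ne
    exact hC ▸ this _
  clear hC
  lift C to ℝ using ⟨htop, hbot⟩
  exact absurd (EReal.add_lt_add_right_coe hlt C) (not_lt.2 h5)

end Myerson

/-! ### Product measures -/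

section Pi

variable {ι : Type*} [Fintype ι] {α : Type*} [MeasurableSpace α]

/-- `Set ι` is finite, so every function of the random set is measurable. -/
lemma measurable_comp_setOf {β γ : Type*} [MeasurableSpace β] [MeasurableSpace γ]
    {P : ι → β → Prop} (hP : ∀ i, MeasurableSet {x | P i x}) (f : Set ι → γ) :
    Measurable fun x => f {i | P i x} := by
  have : Measurable fun x => {i | P i x} :=
    measurable_set_iff.2 fun i => measurableSet_setOfPred.1 (hP i)
  exact (measurable_of_countable f).comp this

variable [DecidableEq ι]

/-- Resampling one coordinate of a vector with independent coordinates does not change its law. -/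
lemma measurePreserving_update (ν : ι → Measure α) [∀ i, IsProbabilityMeasure (ν i)] (i : ι) :
    MeasurePreserving (fun x : α × (ι → α) => Function.update x.2 i x.1)
      ((ν i).prod (Measure.pi ν)) (Measure.pi ν) := by
  have hm : Measurable (fun x : α × (ι → α) => Function.update x.2 i x.1) := by
    refine measurable_pi_lambda _ fun j => ?_
    by_cases hj : j = i
    · subst hj; simpa using measurable_fst
    · simp only [Function.update_of_ne hj]
      exact (measurable_pi_apply j).comp measurable_snd
  refine ⟨hm, (Measure.pi_eq fun s hs => ?_).symm⟩
  rw [Measure.map_apply hm (MeasurableSet.univ_pi hs)]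
  have : (fun x : α × (ι → α) => Function.update x.2 i x.1) ⁻¹' (Set.pi univ s) =
      s i ×ˢ Set.pi univ (Function.update s i univ) := by
    ext ⟨z, w⟩
    simp only [mem_preimage, mem_pi, mem_univ, true_implies, mem_prod]
    constructor
    · intro h
      refine ⟨by simpa using h i, fun j => ?_⟩
      by_cases hj : j = i
      · subst hj; simp
      · simpa [hj] using h j
    · rintro ⟨hz, hw⟩ j
      by_cases hj : j = i
      · subst hj; simpa using hz
      · simpa [hj] using hw j
  rw [this, Measure.prod_prod, Measure.pi_pi, ← Finset.mul_prod_erase _ _ (Finset.mem_univ i),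
    ← Finset.mul_prod_erase (Finset.univ) (fun j => ν j (s j)) (Finset.mem_univ i)]
  simp only [Function.update_self, measure_univ, one_mul]
  congr 1
  refine Finset.prod_congr rfl fun j hj => ?_
  rw [Function.update_of_ne (Finset.ne_of_mem_erase hj)]

/-- Drawing a vector `v` and, for every `i`, a vector `w i` whose `i`-th coordinate is then replaced
by `v i`, yields independent copies of `v`. -/
lemma measurePreserving_update_diag (ν : ι → Measure α) [∀ i, IsProbabilityMeasure (ν i)] :
    MeasurePreserving
      (fun x : (ι → α) × (ι → ι → α) => fun i => Function.update (x.2 i) i (x.1 i))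
      ((Measure.pi ν).prod (Measure.pi fun _ : ι => Measure.pi ν))
      (Measure.pi fun _ : ι => Measure.pi ν) :=
  (measurePreserving_pi (fun i => (ν i).prod (Measure.pi ν)) (fun _ : ι => Measure.pi ν)
      (fun i => measurePreserving_update ν i)).comp
    (measurePreserving_arrowProdEquivProdArrow α (ι → α) ι ν fun _ => Measure.pi ν).symm

/-- Independence of the event `x i ∈ B` from an event that does not involve `x i`. -/
lemma pi_inter_eq_mul (ν : ι → Measure α) [∀ i, IsProbabilityMeasure (ν i)] {i : ι} {B : Set α}
    (hB : MeasurableSet B) {G : Set (ι → α)} (hG : MeasurableSet G)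
    (h : ∀ x z, Function.update x i z ∈ G ↔ x ∈ G) :
    Measure.pi ν {x | x i ∈ B ∧ x ∈ G} = ν i B * Measure.pi ν G := by
  have hm : MeasurableSet {x : ι → α | x i ∈ B ∧ x ∈ G} :=
    ((measurable_pi_apply i) hB).inter hG
  rw [← (measurePreserving_update ν i).measure_preimage hm.nullMeasurableSet,
    ← Measure.prod_prod]
  congr 1
  ext ⟨z, x⟩
  simp [h]

end Pi

/-! ### The rank of a random set -/

section Rank

/-- The counted elements are the coloops of `X`; none is spanned by the others, so they form an
independent subset of `X`. -/
lemma encard_notMem_closure_diff_le {ι : Type*} (M : Matroid ι) {X : Set ι} (hX : X ⊆ M.E) :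
    {i | i ∈ X ∧ i ∉ M.closure (X \ {i})}.encard ≤ M.eRk X := by
  refine Matroid.Indep.encard_le_eRk_of_subset ?_ (fun i hi => hi.1)
  rw [Matroid.indep_iff_forall_notMem_closure_sdiff (fun i hi => hX hi.1)]
  intro i hi hcl
  exact hi.2 (M.closure_subset_closure (sdiff_subset_sdiff_left fun j hj => hj.1) hcl)

lemma sum_indicator_eq_encard {ι : Type*} [Fintype ι] (X : Set ι) :
    ∑ i, X.indicator (fun _ => (1 : ℝ≥0∞)) i = (X.encard : ℝ≥0∞) := by
  classical
  rw [encard_eq_coe_toFinset_card]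
  simp [indicator_apply, Set.toFinset]

variable {ι : Type*} [Fintype ι] [DecidableEq ι] {α : Type*} [MeasurableSpace α]

/-- If the marginals of a random set with independent memberships lie in the independence polytope
of a matroid, the expected rank of the set is at least half of its expected size. -/
lemma sum_measure_le_two_mul_lintegral_eRk (M : Matroid ι) (ν : ι → Measure α)
    [∀ i, IsProbabilityMeasure (ν i)] {B : ι → Set α} (hB : ∀ i, MeasurableSet (B i))
    (hE : ∀ i, (B i).Nonempty → i ∈ M.E)
    (hpoly : ∀ T : Set ι, ∑ i, T.indicator (fun i => ν i (B i)) i ≤ (M.eRk T : ℝ≥0∞)) :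
    ∑ i, ν i (B i) ≤ 2 * ∫⁻ x, (M.eRk {i | x i ∈ B i} : ℝ≥0∞) ∂(Measure.pi ν) := by
  set P := Measure.pi ν with hP
  have hmem (i : ι) : MeasurableSet {x : ι → α | x i ∈ B i} := (measurable_pi_apply i) (hB i)
  have hcl (i : ι) : MeasurableSet {x : ι → α | i ∈ M.closure {j | x j ∈ B j}} :=
    measurableSet_setOfPred.2 (measurable_comp_setOf hmem fun X => i ∈ M.closure X)
  have hcl' (i : ι) : MeasurableSet {x : ι → α | i ∈ M.closure ({j | x j ∈ B j} \ {i})} :=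
    measurableSet_setOfPred.2 (measurable_comp_setOf hmem fun X => i ∈ M.closure (X \ {i}))
  have hfree (i : ι) :
      MeasurableSet {x : ι → α | x i ∈ B i ∧ i ∉ M.closure ({j | x j ∈ B j} \ {i})} :=
    (hmem i).inter (hcl' i).compl
  -- With `X` the random set, either `i` is a coloop of `X`, or it is spanned by `X \ {i}`, an event
  -- independent of `x i`; the latter is then relaxed to `i ∈ closure X`.
  have hsplit (i : ι) : ν i (B i) ≤
      P {x | x i ∈ B i ∧ i ∉ M.closure ({j | x j ∈ B j} \ {i})} +
        ν i (B i) * P {x | i ∈ M.closure {j | x j ∈ B j}} := by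
    have h1 : ν i (B i) = P {x | x i ∈ B i} := by
      rw [← (measurePreserving_eval ν i).measure_preimage (hB i).nullMeasurableSet]
      rfl
    have h2 : P {x | x i ∈ B i ∧ x ∈ {x : ι → α | i ∈ M.closure ({j | x j ∈ B j} \ {i})}} =
        ν i (B i) * P {x | i ∈ M.closure ({j | x j ∈ B j} \ {i})} := by
      refine pi_inter_eq_mul ν (hB i) (hcl' i) fun x z => ?_
      have : {j | Function.update x i z j ∈ B j} \ {i} = {j | x j ∈ B j} \ {i} := by
        ext j
        by_cases hj : j = i <;> simp [hj]
      simp [this]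
    calc ν i (B i) = P {x | x i ∈ B i} := h1
      _ ≤ P ({x | x i ∈ B i ∧ i ∉ M.closure ({j | x j ∈ B j} \ {i})} ∪
          {x | x i ∈ B i ∧ x ∈ {x : ι → α | i ∈ M.closure ({j | x j ∈ B j} \ {i})}}) :=
        measure_mono fun x hx => by
          by_cases h : i ∈ M.closure ({j | x j ∈ B j} \ {i})
          · exact Or.inr ⟨hx, h⟩
          · exact Or.inl ⟨hx, h⟩
      _ ≤ _ := measure_union_le _ _
      _ ≤ _ := by
        rw [h2]
        gcongr
        exact sdiff_subset
  have hfirst : ∑ i, P {x | x i ∈ B i ∧ i ∉ M.closure ({j | x j ∈ B j} \ {i})} ≤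
      ∫⁻ x, (M.eRk {i | x i ∈ B i} : ℝ≥0∞) ∂P := by
    simp_rw [fun i => (lintegral_indicator_one (μ := P) (hfree i)).symm]
    rw [← lintegral_finsetSum _ fun i _ => measurable_one.indicator (hfree i)]
    refine lintegral_mono fun x => ?_
    have hX : {i | x i ∈ B i} ⊆ M.E := fun i hi => hE i ⟨_, hi⟩
    have h := ENat.toENNReal_le.2 (encard_notMem_closure_diff_le M hX)
    rw [← sum_indicator_eq_encard] at h
    exact h
  have hsecond : ∑ i, ν i (B i) * P {x | i ∈ M.closure {j | x j ∈ B j}} ≤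
      ∫⁻ x, (M.eRk {i | x i ∈ B i} : ℝ≥0∞) ∂P := by
    simp_rw [fun i => (lintegral_indicator_const (μ := P) (hcl i) (ν i (B i))).symm]
    rw [← lintegral_finsetSum _ fun i _ => measurable_const.indicator (hcl i)]
    refine lintegral_mono fun x => ?_
    -- The polytope constraint is applied to the random flat spanned by `X`, whose rank is that of
    -- `X`.
    have h := hpoly (M.closure {j | x j ∈ B j})
    rw [M.eRk_closure_eq] at h
    exact h
  calc ∑ i, ν i (B i) ≤ _ := Finset.sum_le_sum fun i _ => hsplit i
    _ ≤ _ := by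
      rw [Finset.sum_add_distrib, two_mul]
      exact add_le_add hfirst hsecond

end Rank

/-! ### The revenue of the VCG mechanism with reserve prices -/

section VCG

variable {J : Matroid (Fin n)} {p : Fin n → ℝ} {V : (Fin n → ℝ) → Finset (Fin n)}

/-- A served agent pays at least the value of every eligible agent that could replace it. -/
lemma IsVCG.le_criticalValue_of_exchange (hV : IsVCG J p V) (hp : ∀ i, 0 ≤ p i) {v : Fin n → ℝ}
    {i j : Fin n} (hi : i ∈ V v) (hj : j ∉ V v) (hpj : p j ≤ v j)
    (hex : J.Indep (insert j ((V v : Set (Fin n)) \ {i}))) : v j ≤ criticalValue V i v := by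
  have hpi := hV.reserve v i hi
  refine le_criticalValue hi ((hp i).trans hpi) fun z _ hz => ?_
  set v' := Function.update v i z with hv'
  have hij : j ≠ i := by rintro rfl; exact hj hi
  have hjE : j ∉ (V v).erase i := fun h => hj (Finset.mem_of_mem_erase h)
  have hagree : ∀ k, k ≠ i → v' k = v k := fun k hk => by simp [hv', hk]
  -- `V v'` may differ from `V v` beyond `i`. Optimality at `v'` against the swap, added to
  -- optimality of `V v` at `v` against `V v'`, cancels all the other values and leaves `v j ≤ z`.
  have h1 := hV.optimal v' (insert j ((V v).erase i)) (by simpa using hex) (by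
    intro k hk
    rcases Finset.mem_insert.1 hk with rfl | hk
    · rw [hagree _ hij]; exact hpj
    · rw [hagree _ (Finset.ne_of_mem_erase hk)]
      exact hV.reserve v k (Finset.mem_of_mem_erase hk))
  have h2 := hV.optimal v (V v') (hV.feasible v') (by
    intro k hk
    by_cases hki : k = i
    · subst hki; exact hpi
    · rw [← hagree k hki]; exact hV.reserve v' k hk)
  rw [Finset.sum_insert hjE, ← Finset.add_sum_erase _ _ hz, hagree j hij,
    Finset.sum_congr rfl fun k hk => hagree k (Finset.ne_of_mem_erase (s := V v) (a := i) hk),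
    Finset.sum_congr rfl fun k hk => hagree k (Finset.ne_of_mem_erase (s := V v') (a := i) hk)]
    at h1
  rw [← Finset.add_sum_erase _ _ hz, ← Finset.add_sum_erase _ _ hi] at h2
  have : v' i = z := by simp [hv']
  linarith

lemma IsVCG.le_criticalValue_of_mem (hV : IsVCG J p V) (hp : ∀ i, 0 ≤ p i) {v : Fin n → ℝ}
    {i : Fin n} (hi : i ∈ V v) : p i ≤ criticalValue V i v :=
  le_criticalValue hi ((hp i).trans (hV.reserve v i hi)) fun z _ hz => by
    simpa using hV.reserve _ i hz

/-- The agents that pay more than `s` span the eligible agents with reserves above `s`. -/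
lemma IsVCG.eRk_le_encard (hV : IsVCG J p V) (hp : ∀ i, 0 ≤ p i) (v : Fin n → ℝ) {s : ℝ}
    (hs : 0 ≤ s) :
    J.eRk {j | p j ≤ v j ∧ s < p j} ≤ {i | i ∈ V v ∧ s < criticalValue V i v}.encard := by
  set W : Set (Fin n) := {i | i ∈ V v ∧ s < criticalValue V i v} with hW
  have hWV : W ⊆ (V v : Set (Fin n)) := fun i hi => hi.1
  have hWI : J.Indep W := (hV.feasible v).subset hWV
  rw [← hWI.eRk_eq_encard, ← J.eRk_closure_eq W, ← J.eRk_inter_ground]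
  refine J.eRk_mono ?_
  rintro j ⟨⟨hpj, hsj⟩, hjE⟩
  by_cases hjV : j ∈ V v
  · exact J.mem_closure_of_mem ⟨hjV, hsj.trans_le (hV.le_criticalValue_of_mem hp hjV)⟩
      hWI.subset_ground
  by_contra hcl
  have hjW : J.Indep (insert j W) := hWI.insert_indep_iff.2 (Or.inl ⟨hjE, hcl⟩)
  obtain ⟨K, hK, hWK⟩ := hjW.subset_isBasis_of_subset
    (insert_subset_insert hWV) (insert_subset hjE (hV.feasible v).subset_ground)
  have hjK : j ∈ K := hWK (mem_insert _ _)
  -- `K` does not contain all of `V v`, as `V v` is optimal and `v j` is positive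
  obtain ⟨i, hiV, hiK⟩ : ∃ i ∈ V v, i ∉ K := by
    by_contra! h
    have hins : J.Indep (insert j (V v) : Finset (Fin n)) := by
      refine hK.indep.subset ?_
      rw [Finset.coe_insert]
      exact insert_subset hjK h
    have h1 := hV.optimal v _ hins (by
      intro k hk
      rcases Finset.mem_insert.1 hk with rfl | hk
      exacts [hpj, hV.reserve v k hk])
    rw [Finset.sum_insert hjV] at h1
    linarith
  have hKsub : K ⊆ insert j ((V v : Set (Fin n)) \ {i}) := by
    intro k hk
    rcases hK.subset hk with rfl | hkV
    · exact mem_insert _ _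
    · exact mem_insert_of_mem _ ⟨hkV, by rintro rfl; exact hiK hk⟩
  -- A basis of `V v ∪ {j}` has at least as many elements as `V v`, so `K` is exactly the swap of
  -- `i` for `j`. Then `i` pays at least `v j > s`, which puts it in `W ⊆ K`.
  have hcard : (insert j ((V v : Set (Fin n)) \ {i})).encard ≤ K.encard := by
    have h1 : (insert j ((V v : Set (Fin n)) \ {i})).encard = (V v : Set (Fin n)).encard := by
      rw [encard_insert_of_notMem (fun h => hjV h.1)]
      exact encard_sdiff_singleton_add_one hiV
    rw [h1, hK.encard_eq_eRk]
    exact (hV.feasible v).encard_le_eRk_of_subset (subset_insert _ _)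
  have hKeq : K = insert j ((V v : Set (Fin n)) \ {i}) :=
    (Set.toFinite _).eq_of_subset_of_encard_le hKsub hcard
  have hle := hV.le_criticalValue_of_exchange hp hiV hjV hpj (hKeq ▸ hK.indep)
  exact hiK (hWK (mem_insert_of_mem _ ⟨hiV, by linarith⟩))

end VCG

/-! ### Revenue as an integral over price levels -/

lemma ofReal_eq_lintegral (x : ℝ) :
    ENNReal.ofReal x = ∫⁻ s in Ioi (0 : ℝ), (Iio x).indicator (fun _ => (1 : ℝ≥0∞)) s := by
  rw [lintegral_indicator_const measurableSet_Iio, one_mul,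
    Measure.restrict_apply measurableSet_Iio, Iio_inter_Ioi, Real.volume_Ioo, sub_zero]

lemma sum_ofReal_thresholdPrice (A : (Fin n → ℝ) → Finset (Fin n)) (v : Fin n → ℝ) :
    ∑ i, ENNReal.ofReal (thresholdPrice A v i) =
      ∫⁻ s in Ioi (0 : ℝ), ({i | i ∈ A v ∧ s < criticalValue A i v}.encard : ℝ≥0∞) := by
  simp_rw [ofReal_eq_lintegral]
  rw [← lintegral_finsetSum _ fun i _ => measurable_const.indicator measurableSet_Iio]
  refine setLIntegral_congr_fun measurableSet_Ioi fun s hs => ?_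
  rw [← sum_indicator_eq_encard]
  refine Finset.sum_congr rfl fun i _ => ?_
  by_cases hi : i ∈ A v
  · simp [indicator_apply, thresholdPrice_of_mem hi, hi]
  · simp [thresholdPrice, hi, (mem_Ioi.1 hs).le]

/-- A lower bound for the expected revenue of the VCG mechanism with reserve prices `p`: the
expected maximal total reserve of a feasible set of agents that meet their reserves. -/
def reserveRevenue (J : Matroid (Fin n)) (μ : Fin n → Measure ℝ) (p : Fin n → ℝ) : ℝ≥0∞ :=
  ∫⁻ v, (∫⁻ s in Ioi (0 : ℝ), (J.eRk {i | p i ≤ v i ∧ s < p i} : ℝ≥0∞)) ∂(Measure.pi μ)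

/-- The comparison is pointwise in `v` and `s`, so an arbitrary, possibly nonmeasurable tie-breaking
does no harm. -/
lemma IsVCG.reserveRevenue_le {J : Matroid (Fin n)} {p : Fin n → ℝ}
    {V : (Fin n → ℝ) → Finset (Fin n)} (hV : IsVCG J p V) (hp : ∀ i, 0 ≤ p i)
    (μ : Fin n → Measure ℝ) : reserveRevenue J μ p ≤ expectedRevenue μ V := by
  refine lintegral_mono fun v => ?_
  rw [sum_ofReal_thresholdPrice]
  exact setLIntegral_mono' measurableSet_Ioi fun s hs =>
    ENat.toENNReal_le.2 (hV.eRk_le_encard hp v (mem_Ioi.1 hs).le)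

section

variable {μ : Fin n → Measure ℝ} [∀ i, IsProbabilityMeasure (μ i)]

/-- Rank is at most cardinality, so the bound is the sum of the single-buyer revenues at the prices
`p i`. -/
lemma exists_reserveRevenue_le (J : Matroid (Fin n))
    (hfin : ∀ i, BddAbove (range fun z : ℝ => z * (μ i).real (Ici z))) :
    ∃ C : ℝ≥0∞, C ≠ ∞ ∧ ∀ p : Fin n → ℝ, reserveRevenue J μ p ≤ C := by
  choose B hB using hfin
  refine ⟨∑ i, ENNReal.ofReal (B i), by simp, fun p => ?_⟩
  have hm (i : Fin n) : MeasurableSet {v : Fin n → ℝ | p i ≤ v i} :=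
    measurableSet_le measurable_const (measurable_pi_apply i)
  calc reserveRevenue J μ p
      ≤ ∫⁻ v, ∑ i, {v : Fin n → ℝ | p i ≤ v i}.indicator
          (fun _ => ENNReal.ofReal (p i)) v ∂(Measure.pi μ) := by
        refine lintegral_mono fun v => ?_
        calc ∫⁻ s in Ioi (0 : ℝ), (J.eRk {i | p i ≤ v i ∧ s < p i} : ℝ≥0∞)
            ≤ ∫⁻ s in Ioi (0 : ℝ), ∑ i, {v : Fin n → ℝ | p i ≤ v i}.indicator
                (fun _ => (Iio (p i)).indicator (fun _ => (1 : ℝ≥0∞)) s) v := by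
              refine lintegral_mono fun s => ?_
              refine (ENat.toENNReal_le.2 (J.eRk_le_encard _)).trans_eq ?_
              rw [← sum_indicator_eq_encard]
              refine Finset.sum_congr rfl fun i _ => ?_
              by_cases hi : p i ≤ v i <;> simp [indicator_apply, hi]
          _ = ∑ i, ∫⁻ s in Ioi (0 : ℝ), {v : Fin n → ℝ | p i ≤ v i}.indicator
                (fun _ => (Iio (p i)).indicator (fun _ => (1 : ℝ≥0∞)) s) v := by
              refine lintegral_finsetSum _ fun i _ => ?_
              by_cases hi : p i ≤ v i
              · simpa [indicator_apply (s := {v : Fin n → ℝ | p i ≤ v i}), hi] using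
                  measurable_const.indicator measurableSet_Iio
              · simp [hi]
          _ ≤ _ := by
              refine Finset.sum_le_sum fun i _ => ?_
              by_cases hi : p i ≤ v i
              · simp only [indicator_apply (s := {v : Fin n → ℝ | p i ≤ v i}), mem_ofPred_eq, hi,
                  if_true]
                rw [← ofReal_eq_lintegral]
              · simp [hi]
    _ = ∑ i, ENNReal.ofReal (p i) * μ i (Ici (p i)) := by
        rw [lintegral_finsetSum _ fun i _ => measurable_const.indicator (hm i)]
        refine Finset.sum_congr rfl fun i _ => ?_
        rw [lintegral_indicator_const (hm i),
          ← (measurePreserving_eval μ i).measure_preimage measurableSet_Ici.nullMeasurableSet]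
        rfl
    _ ≤ _ := by
        refine Finset.sum_le_sum fun i _ => ?_
        rw [← ofReal_measureReal, ← ENNReal.ofReal_mul' measureReal_nonneg]
        exact ENNReal.ofReal_le_ofReal (hB i ⟨p i, rfl⟩)

/-! ### Random reserve prices -/

/-- The value vectors at which the rule `A` charges agent `i` more than `s`. -/
def chargedAbove (A : (Fin n → ℝ) → Finset (Fin n)) (i : Fin n) (s : ℝ) : Set (Fin n → ℝ) :=
  {v | i ∈ A v ∧ 0 ≤ v i ∧ s < criticalValue A i v}

variable {J : Matroid (Fin n)} {A : (Fin n → ℝ) → Finset (Fin n)}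

lemma measurableSet_chargedAbove (hA : ∀ i, MeasurableSet {v | i ∈ A v})
    (hcrit : ∀ i, Measurable (criticalValue A i)) (i : Fin n) :
    MeasurableSet {x : (Fin n → ℝ) × ℝ | x.1 ∈ chargedAbove A i x.2} :=
  (measurable_fst (hA i)).inter <|
    (measurableSet_le measurable_const ((measurable_pi_apply i).comp measurable_fst)).inter
      (measurableSet_lt measurable_snd ((hcrit i).comp measurable_fst))

lemma expectedRevenue_eq (hnonneg : ∀ i, μ i (Iio 0) = 0) (hA : ∀ i, MeasurableSet {v | i ∈ A v})
    (hcrit : ∀ i, Measurable (criticalValue A i)) :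
    expectedRevenue μ A =
      ∫⁻ s in Ioi (0 : ℝ), ∑ i, Measure.pi μ (chargedAbove A i s) := by
  have hm := measurableSet_chargedAbove hA hcrit
  have hpos : ∀ᵐ v ∂(Measure.pi μ), ∀ i, 0 ≤ v i := by
    refine ae_all_iff.2 fun i => ?_
    have h : ∀ᵐ z ∂(μ i), 0 ≤ z := by
      rw [ae_iff]
      simp only [not_le]
      exact hnonneg i
    exact (measurePreserving_eval μ i).quasiMeasurePreserving.ae h
  have hm' : Measurable (Function.uncurry fun (v : Fin n → ℝ) (s : ℝ) =>
      ∑ i, (chargedAbove A i s).indicator (fun _ => (1 : ℝ≥0∞)) v) :=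
    Finset.measurable_sum _ fun i _ => measurable_const.indicator (hm i)
  calc expectedRevenue μ A
      = ∫⁻ v, (∫⁻ s in Ioi (0 : ℝ),
          ∑ i, (chargedAbove A i s).indicator (fun _ => (1 : ℝ≥0∞)) v) ∂(Measure.pi μ) := by
        refine lintegral_congr_ae (hpos.mono fun v hv => ?_)
        simp only [sum_ofReal_thresholdPrice, ← sum_indicator_eq_encard]
        simp [indicator_apply, chargedAbove, hv]
    _ = ∫⁻ s in Ioi (0 : ℝ), ∫⁻ v,
          ∑ i, (chargedAbove A i s).indicator (fun _ => (1 : ℝ≥0∞)) v ∂(Measure.pi μ) :=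
        lintegral_lintegral_swap hm'.aemeasurable
    _ = _ := by
        refine lintegral_congr fun s => ?_
        have hms (i : Fin n) : MeasurableSet (chargedAbove A i s) :=
          (measurable_id.prodMk measurable_const : Measurable fun v : Fin n → ℝ => (v, s)) (hm i)
        rw [lintegral_finsetSum _ fun i _ => measurable_const.indicator (hms i)]
        exact Finset.sum_congr rfl fun i _ => by
          rw [lintegral_indicator_const (hms i), one_mul]

/-- The agents that are charged more than `s` are served together. -/
lemma sum_indicator_chargedAbove_le (hfeas : ∀ v, J.Indep (A v : Set (Fin n)))
    (hms : ∀ i s, MeasurableSet (chargedAbove A i s)) (s : ℝ) (T : Set (Fin n)) :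
    ∑ i, T.indicator (fun i => Measure.pi μ (chargedAbove A i s)) i ≤ (J.eRk T : ℝ≥0∞) := by
  have h1 (i : Fin n) : T.indicator (fun i => Measure.pi μ (chargedAbove A i s)) i =
      ∫⁻ v, {i | i ∈ T ∧ v ∈ chargedAbove A i s}.indicator (fun _ => (1 : ℝ≥0∞)) i
        ∂(Measure.pi μ) := by
    by_cases hi : i ∈ T
    · rw [indicator_of_mem hi, ← lintegral_indicator_one (hms i s)]
      refine lintegral_congr fun v => ?_
      by_cases hv : v ∈ chargedAbove A i s <;> simp [hi, hv]
    · simp [hi]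
  have hmeas (i : Fin n) : Measurable fun v : Fin n → ℝ =>
      {i | i ∈ T ∧ v ∈ chargedAbove A i s}.indicator (fun _ => (1 : ℝ≥0∞)) i :=
    measurable_comp_setOf (P := fun i v => i ∈ T ∧ v ∈ chargedAbove A i s)
      (fun i => (MeasurableSet.const _).inter (hms i s))
      (fun X => X.indicator (fun _ => (1 : ℝ≥0∞)) i)
  simp_rw [h1]
  rw [← lintegral_finsetSum _ fun i _ => hmeas i]
  refine (lintegral_mono (g := fun _ => (J.eRk T : ℝ≥0∞)) fun v => ?_).trans_eq (by simp)
  rw [sum_indicator_eq_encard]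
  exact ENat.toENNReal_le.2 (((hfeas v).subset fun i hi => hi.2.1).encard_le_eRk_of_subset
    fun i hi => hi.1)

/-- If every agent is offered the price that it would face in the mechanism `A` in an independent
copy of the market, the expected revenue with these reserves is at least half of that of `A`. -/
lemma expectedRevenue_le_lintegral_reserveRevenue (hnonneg : ∀ i, μ i (Iio 0) = 0)
    (hfeas : ∀ v, J.Indep (A v : Set (Fin n))) (hA : ∀ i, MeasurableSet {v | i ∈ A v})
    (hcrit : ∀ i, Measurable (criticalValue A i)) :
    expectedRevenue μ A ≤ 2 * ∫⁻ w, reserveRevenue J μ (fun i => criticalValue A i (w i))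
      ∂(Measure.pi fun _ : Fin n => Measure.pi μ) := by
  have hm := measurableSet_chargedAbove hA hcrit
  have hms (i : Fin n) (s : ℝ) : MeasurableSet (chargedAbove A i s) :=
    (measurable_id.prodMk measurable_const : Measurable fun v : Fin n → ℝ => (v, s)) (hm i)
  set Q := Measure.pi fun _ : Fin n => Measure.pi μ with hQ
  -- membership of the active set, with the realized values and the copies of the market
  set P : Fin n → ((Fin n → ℝ) × (Fin n → Fin n → ℝ)) × ℝ → Prop :=
    fun i x => Function.update (x.1.2 i) i (x.1.1 i) ∈ chargedAbove A i x.2 with hPdef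
  have hP (i : Fin n) : MeasurableSet {x | P i x} := by
    refine measurableSet_preimage (f := fun x : ((Fin n → ℝ) × (Fin n → Fin n → ℝ)) × ℝ =>
      (Function.update (x.1.2 i) i (x.1.1 i), x.2)) ?_ (hm i)
    exact (((measurable_pi_apply i).comp
      (measurePreserving_update_diag μ).measurable).comp measurable_fst).prodMk measurable_snd
  have hF : Measurable fun x => (J.eRk {i | P i x} : ℝ≥0∞) :=
    measurable_comp_setOf hP fun X => (J.eRk X : ℝ≥0∞)
  have hFs (s : ℝ) : Measurable fun u : Fin n → Fin n → ℝ =>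
      (J.eRk {i | u i ∈ chargedAbove A i s} : ℝ≥0∞) :=
    measurable_comp_setOf (P := fun i (u : Fin n → Fin n → ℝ) => u i ∈ chargedAbove A i s)
      (fun i => (measurable_pi_apply i) (hms i s)) fun X => (J.eRk X : ℝ≥0∞)
  rw [expectedRevenue_eq hnonneg hA hcrit]
  calc ∫⁻ s in Ioi (0 : ℝ), ∑ i, Measure.pi μ (chargedAbove A i s)
      ≤ ∫⁻ s in Ioi (0 : ℝ), 2 * ∫⁻ x, (J.eRk {i | P i (x, s)} : ℝ≥0∞)
          ∂((Measure.pi μ).prod Q) := by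
        refine lintegral_mono fun s => ?_
        refine (sum_measure_le_two_mul_lintegral_eRk J (fun _ : Fin n => Measure.pi μ)
          (B := fun i => chargedAbove A i s) (fun i => hms i s)
          (fun i ⟨v, hv⟩ => (hfeas v).subset_ground hv.1)
          (sum_indicator_chargedAbove_le hfeas hms s)).trans_eq ?_
        -- The independent markets are realized by planting the true values `v i` in the sampled `w
        -- i`.
        rw [← (measurePreserving_update_diag μ).lintegral_comp (hFs s)]
    _ = 2 * ∫⁻ x, (∫⁻ s in Ioi (0 : ℝ), (J.eRk {i | P i (x, s)} : ℝ≥0∞))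
          ∂((Measure.pi μ).prod Q) := by
        rw [lintegral_const_mul' _ _ (by simp)]
        congr 1
        exact (lintegral_lintegral_swap
          (f := fun x s => (J.eRk {i | P i (x, s)} : ℝ≥0∞)) hF.aemeasurable).symm
    _ = 2 * ∫⁻ w, (∫⁻ v, (∫⁻ s in Ioi (0 : ℝ), (J.eRk {i | P i ((v, w), s)} : ℝ≥0∞))
          ∂(Measure.pi μ)) ∂Q := by
        rw [lintegral_prod_symm' _ (Measurable.lintegral_prod_right' hF)]
    _ ≤ _ := by
        gcongr with w
        refine lintegral_mono fun v => lintegral_mono fun s => ENat.toENNReal_le.2 (J.eRk_mono ?_)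
        -- Being served in the planted market forces `v i` to reach the quoted price; `hv` is needed
        -- because the critical value ranges over nonnegative reports only.
        rintro i ⟨hi, hv, hs⟩
        refine ⟨?_, by simpa [criticalValue_update] using hs⟩
        simpa [criticalValue_update] using criticalValue_le hi hv

end

end

end BSMD

theorem mainTheorem2 {n : ℕ} (J : Matroid (Fin n)) (μ : Fin n → Measure ℝ)
    [∀ i, IsProbabilityMeasure (μ i)]
    (hnonneg : ∀ i, μ i (Iio 0) = 0)
    (hfin : ∀ i, BddAbove (range fun z : ℝ => z * (μ i).real (Ici z)))
    (Mye : (Fin n → ℝ) → Finset (Fin n)) (hMye : BSMD.IsMyerson J μ Mye) :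
    ∃ p : Fin n → ℝ, (∀ i, 0 ≤ p i) ∧
      ∀ V : (Fin n → ℝ) → Finset (Fin n), BSMD.IsVCG J p V →
        BSMD.expectedRevenue μ Mye / 2 ≤ BSMD.expectedRevenue μ V := by
  have hA := hMye.measurableSet_mem hnonneg hfin
  have hcrit := fun i =>
    BSMD.measurable_criticalValue (hMye.isMonotoneRule hnonneg hfin) (hA i)
  have hle := BSMD.expectedRevenue_le_lintegral_reserveRevenue hnonneg hMye.feasible hA hcrit
  obtain ⟨C, hC, hbound⟩ := BSMD.exists_reserveRevenue_le (μ := μ) J hfin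
  have hfinite : ∫⁻ w, BSMD.reserveRevenue J μ (fun i => BSMD.criticalValue Mye i (w i))
      ∂(Measure.pi fun _ : Fin n => Measure.pi μ) ≠ ∞ := by
    refine ne_top_of_le_ne_top hC ((lintegral_mono fun w => hbound _).trans_eq ?_)
    simp
  -- Some sample does at least as well as the average; this fixes deterministic reserves.
  obtain ⟨w, hw⟩ := exists_lintegral_le hfinite
  have hp : ∀ i, 0 ≤ BSMD.criticalValue Mye i (w i) := fun i =>
    BSMD.criticalValue_nonneg Mye i (w i)
  refine ⟨fun i => BSMD.criticalValue Mye i (w i), hp, fun V hV => ?_⟩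
  rw [ENNReal.div_le_iff_le_mul (by simp) (by simp), mul_comm]
  refine hle.trans ?_
  gcongr
  exact hw.trans (hV.reserveRevenue_le hp μ)
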